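/- Let $K=K_1\times\dots\times K_m$ be an étale $\mathbb{Q}$-algebra (a finite product of number fields) and $\mathcal{O}_K=\mathcal{O}_{K_1}\times\dots\times\mathcal{O}_{K_m}$ its ring of integers. An ideal $\mathfrak b=\mathfrak b_1\times\dots\times\mathfrak b_m$ of $\mathcal O_K$ is called invertible if all $\mathfrak b_j\neq 0$; then $N(\mathfrak b)=|\mathcal O_K/\mathfrak b|<\infty$. For $A\subset\mathcal O_K$ let $|A+\mathfrak b|$ denote the number of residue classes modulo $\mathfrak b$ that meet $A$. A sieve $R$ over $K$ consists of an infinite set $\mathcal B_R$ of pairwise coprime invertible ideals of $\mathcal O_K$ and, for each $\mathfrak b\in\mathcal B_R$, a set $R_{\mathfrak b}\neq\mathcal O_K$ that is a finite (possibly empty) union of residue classes modulo $\mathfrak b$. Write $\mathcal B_R=\{\mathfrak b_1,\mathfrak b_2,\dots\}$ (distinct ideals), $R_i=R_{\mathfrak b_i}$, $R_i^c=\mathcal O_K\setminus R_i$, and let $|R_i|$, $|R_i^c|$ be the numbers of residue classes modulo $\mathfrak b_i$ contained in $R_i$, $R_i^c$. Identify subsets of $\mathcal O_K$ with points of $\{0,1\}^{\mathcal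 O_K}$ (product topology), on which $\mathcal O_K$ acts by the shift $S_a(A)=A-a$. A set $A\subset\mathcal O_K$ is $R$-admissible if $-A+R_i\neq\mathcal O_K$ for every $i$; $\Omega_R$ is the set of all $R$-admissible sets. For a sequence $\underline s=(s_1,s_2,\dots)$ of non-negative integers with $s_i\le|R_i^c|$ for every $i$, put $$Y_{R,\ge\underline s}=\{A\in\Omega_R:\ |A+\mathfrak b_i|\le|R_i^c|-s_i\text{ for every }i\}.$$ Both $\Omega_R$ and $Y_{R,\ge\underline s}$ are closed and $S$-invariant. For an action of $\mathcal O_K$ on a compact space $X$, the topological entropy is $$h_{\mathrm{top}}(X)=\sup_{\mathcal U}\ \lim_{F}\ \frac{1}{|F|}\log N\Big(\bigvee_{a\in F}S_a^{-1}\mathcal U\Big),$$ where $\mathcal U$ runs over the finite open covers of $X$, $N(\cdot)$ is the smallest cardinality of a subcover, and the limit is taken as the finite non-empty set $F\subset\mathcal O_K$ becomes more and more invariant under translations (that is, $|(x+F)\,\triangle\,F|/|F|\to0$ for every $x\in\mathcal O_K$). Then, for every sieve $R$ over $K$ and every such sequence $\underline s$, $$h_{\mathrm{top}}(Y_{R,\ge\underline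 s},S)=\log 2\cdot\prod_i\frac{|R_i^c|-s_i}{N(\mathfrak b_i)}.$$ In particular, $$h_{\mathrm{top}}(\Omega_R,S)=\log 2\cdot\prod_i\Big(1-\frac{|R_i|}{N(\mathfrak b_i)}\Big).$$ Here the infinite products are limits of finite partial products; they converge, independently of the order of the factors, to a value in $[0,1]$ that may be $0$. -/

import Mathlib

open Filter Topology Set
open scoped Pointwise NumberField

/-! ### Topological entropy of an action of a discrete abelian group -/

/-- The filter on the finite subsets of `G` along which they are non-empty and
become more and more invariant under translation: a sequence `I` of finite sets tends to it
if and only if the `I N` are eventually non-empty and `|(x + I N) ∆ I N| / |I N| → 0` for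
every `x`. -/
noncomputable def folnerFilter (G : Type*) [AddCommGroup G] : Filter (Finset G) :=
  𝓟 {F | F.Nonempty} ⊓
    ⨅ x : G, comap (fun F : Finset G =>
      (((symmDiff (x +ᵥ (F : Set G)) (F : Set G)).ncard : ℝ) / (F.card : ℝ))) (𝓝 0)

/-- `𝒰` is a finite open cover of `X`. -/
def IsFiniteOpenCover {X : Type*} [TopologicalSpace X] (𝒰 : Set (Set X)) : Prop :=
  𝒰.Finite ∧ (∀ u ∈ 𝒰, IsOpen u) ∧ ⋃₀ 𝒰 = univ

/-- The smallest number of elements of a subcover of the cover `𝒰`. -/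
noncomputable def minSubcoverCard {X : Type*} (𝒰 : Set (Set X)) : ℕ :=
  sInf {n | ∃ 𝒱 : Finset (Set X), (𝒱 : Set (Set X)) ⊆ 𝒰 ∧ ⋃₀ (𝒱 : Set (Set X)) = univ ∧
    𝒱.card = n}

/-- The join `⋁_{g ∈ F} g⁻¹ 𝒰` of a cover `𝒰`: its members are the intersections
`⋂_{g ∈ F} g⁻¹ u_g` with all `u_g ∈ 𝒰`. -/
def coverJoin {G X : Type*} [AddCommGroup G] [AddAction G X] (𝒰 : Set (Set X))
    (F : Finset G) : Set (Set X) :=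
  {w | ∃ u : G → Set X, (∀ g, u g ∈ 𝒰) ∧ w = ⋂ g ∈ F, {x : X | g +ᵥ x ∈ u g}}

/-- The entropy of a finite open cover: the limit of `log N(⋁_{g ∈ F} g⁻¹ 𝒰) / |F|` as the finite
set `F` becomes more and more invariant (the upper limit, which always makes sense; for a finite
open cover it is a limit by the Ornstein–Weiss lemma). -/
noncomputable def coverEntropy (G : Type*) {X : Type*} [AddCommGroup G] [AddAction G X]
    (𝒰 : Set (Set X)) : EReal :=
  limsup (fun F : Finset G =>
    ((Real.log (minSubcoverCard (coverJoin 𝒰 F)) / (F.card : ℝ) : ℝ) : EReal)) (folnerFilter G)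

/-- The topological entropy of an action of `G` on `X`: the supremum of the entropies of the finite
open covers of `X`. -/
noncomputable def topEntropy (G X : Type*) [AddCommGroup G] [TopologicalSpace X]
    [AddAction G X] : EReal :=
  ⨆ (𝒰 : Set (Set X)) (_ : IsFiniteOpenCover 𝒰), coverEntropy G 𝒰

/-! ### Shift spaces over the alphabet `{0, 1}` -/

/-- The subset of `G` with indicator function `x`. -/
def patternSet {G : Type*} (x : G → Bool) : Set G := {a | x a = true}

/-- The shift `S_a`. On subsets of `G` it is `A ↦ A - a`. -/
def shift {G : Type*} [AddCommGroup G] (a : G) (x : G → Bool) : G → Bool :=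
  fun m => x (m + a)

theorem patternSet_shift {G : Type*} [AddCommGroup G] (a : G) (x : G → Bool) :
    patternSet (shift a x) = (fun m => m - a) '' patternSet x := by
  ext m
  constructor
  · intro h
    exact ⟨m + a, h, by simp⟩
  · rintro ⟨b, hb, rfl⟩
    simpa [patternSet, shift] using hb

/-- A closed shift-invariant subset of `{0,1}^G` (`G → Bool` has the product topology). -/
structure Subshift (G : Type*) [AddCommGroup G] where
  carrier : Set (G → Bool)
  isClosed : IsClosed carrier
  shift_mem : ∀ (a : G), ∀ x ∈ carrier, shift a x ∈ carrier

/-- The shift action of `G` on a subshift. -/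
instance Subshift.addAction {G : Type*} [AddCommGroup G] (Y : Subshift G) :
    AddAction G Y.carrier where
  vadd a x := ⟨shift a x.1, Y.shift_mem a x.1 x.2⟩
  zero_vadd x := Subtype.ext (funext fun m => congrArg x.1 (add_zero m))
  add_vadd a b x := Subtype.ext (funext fun m => congrArg x.1 (by abel : m + (a + b) = m + a + b))

/-! ### Sieves -/

/-- The ring of integers of the étale `ℚ`-algebra `∏ i, K i`. -/
abbrev EtaleIntegers {ι : Type*} (K : ι → Type*) [∀ i, Field (K i)] : Type _ :=
  ∀ i, 𝓞 (K i)

/-- All components of the ideal `I` (its images in the factors `𝓞 (K i)`) are non-zero. -/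
def IsInvertibleIdeal {ι : Type*} {K : ι → Type*} [∀ i, Field (K i)]
    (I : Ideal (EtaleIntegers K)) : Prop :=
  ∀ i, I.map (Pi.evalRingHom (fun i => 𝓞 (K i)) i) ≠ ⊥

/-- The number of residue classes modulo `I` met by `A`. -/
noncomputable def cardMod {O : Type*} [CommRing O] (I : Ideal O) (A : Set O) : ℕ :=
  (Ideal.Quotient.mk I '' A).ncard

/-- The norm `|O / I|` of an ideal. -/
noncomputable def idealNorm {O : Type*} [CommRing O] (I : Ideal O) : ℕ := Nat.card (O ⧸ I)

/-- A sieve over the étale `ℚ`-algebra `∏ i, K i`: an infinite set of pairwise coprime invertible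
ideals of its ring of integers and, for each of these ideals, a finite union of residue classes
that is not everything. -/
structure Sieve {ι : Type*} (K : ι → Type*) [∀ i, Field (K i)] where
  ideals : Set (Ideal (EtaleIntegers K))
  infinite : ideals.Infinite
  coprime : ideals.Pairwise fun I J => I ⊔ J = ⊤
  invertible : ∀ I ∈ ideals, IsInvertibleIdeal I
  res : ideals → Set (EtaleIntegers K)
  res_eq : ∀ b : ideals, ∃ S : Set (EtaleIntegers K), S.Finite ∧
    res b = S + (b.1 : Set (EtaleIntegers K))
  res_ne : ∀ b : ideals, res b ≠ univ

theorem finite_quotient_of_isInvertibleIdeal {ι : Type*} [Finite ι] {K : ι → Type*}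
    [∀ i, Field (K i)] [∀ i, NumberField (K i)] {I : Ideal (EtaleIntegers K)}
    (hI : IsInvertibleIdeal I) : Finite (EtaleIntegers K ⧸ I) := by
  classical
  have := Fintype.ofFinite ι
  let J : ∀ i, Ideal (𝓞 (K i)) := fun i => I.map (Pi.evalRingHom (fun i => 𝓞 (K i)) i)
  have hfin : ∀ i, Finite (𝓞 (K i) ⧸ J i) := fun i =>
    Ideal.finiteQuotientOfFreeOfNeBot (J i) (hI i)
  have key : ∀ z : EtaleIntegers K, (∀ i, z i ∈ J i) → z ∈ I := by
    intro z hz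
    have h1 : ∀ i, ∃ w ∈ I, w i = z i := fun i => by
      have := (Ideal.mem_map_iff_of_surjective (Pi.evalRingHom (fun i => 𝓞 (K i)) i)
        (Function.surjective_eval i)).1 (hz i)
      simpa using this
    choose w hw hwz using h1
    have h2 : z = ∑ i, (Pi.single i (1 : 𝓞 (K i)) : EtaleIntegers K) * w i := by
      funext j
      rw [Finset.sum_apply, Finset.sum_eq_single j]
      · simp [hwz]
      · intro i _ hij
        simp [hij.symm]
      · simp
    rw [h2]
    exact I.sum_mem fun i _ => I.mul_mem_left _ (hw i)
  refine Finite.of_injective (β := ∀ i, 𝓞 (K i) ⧸ J i)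
    (fun q => fun i => Ideal.Quotient.mk (J i) (Quotient.out q i)) ?_
  intro q q' h
  have h3 : Quotient.out q - Quotient.out q' ∈ I :=
    key _ fun i => Ideal.Quotient.eq.1 (congrFun h i)
  have h4 := Ideal.Quotient.eq.2 h3
  rwa [Ideal.Quotient.mk_out, Ideal.Quotient.mk_out] at h4

/-- A property of subsets that passes to larger sets and only needs finitely many elements to hold
is open. -/
theorem isOpen_of_finite_witness {G : Type*} (Q : Set G → Prop)
    (hmono : ∀ A B, A ⊆ B → Q A → Q B)
    (hfin : ∀ A, Q A → ∃ F : Set G, F.Finite ∧ F ⊆ A ∧ Q F) :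
    IsOpen {x : G → Bool | Q (patternSet x)} := by
  rw [isOpen_iff_forall_mem_open]
  intro x hx
  obtain ⟨F, hF, hFx, hQ⟩ := hfin _ hx
  refine ⟨{y | ∀ a ∈ F, y a = true}, fun y hy => hmono F _ (fun a ha => hy a ha) hQ, ?_,
    fun a ha => hFx ha⟩
  have : {y : G → Bool | ∀ a ∈ F, y a = true} = F.pi fun _ => {true} := by
    ext y; simp [Set.pi]
  rw [this]
  exact isOpen_set_pi hF fun _ _ => isOpen_discrete _

namespace Sieve

variable {ι : Type*} {K : ι → Type*} [∀ i, Field (K i)]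

/-- `|R_b|` -/
noncomputable def resCard (R : Sieve K) (b : R.ideals) : ℕ := cardMod b.1 (R.res b)

/-- `|R_b^c|` -/
noncomputable def complCard (R : Sieve K) (b : R.ideals) : ℕ := cardMod b.1 (R.res b)ᶜ

/-- `A` is `R`-admissible. -/
def Admissible (R : Sieve K) (A : Set (EtaleIntegers K)) : Prop :=
  ∀ b : R.ideals, -A + R.res b ≠ univ

theorem isClosed_admissible [Finite ι] [∀ i, NumberField (K i)] (R : Sieve K) :
    IsClosed {x | R.Admissible (patternSet x)} := by
  have : {x | R.Admissible (patternSet x)} =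
      ⋂ b : R.ideals, {x | ¬ (-(patternSet x) + R.res b = univ)} := by
    ext x; simp [Admissible]
  rw [this]
  refine isClosed_iInter fun b => ⟨?_⟩
  have hc : {x : EtaleIntegers K → Bool | ¬ (-(patternSet x) + R.res b = univ)}ᶜ =
      {x | -(patternSet x) + R.res b = univ} := by
    ext x; simp
  rw [hc]
  refine isOpen_of_finite_witness (fun A => -A + R.res b = univ) ?_ ?_
  · intro A B hAB hA
    exact univ_subset_iff.1 (hA ▸ Set.add_subset_add (Set.neg_subset_neg.2 hAB) subset_rfl)
  · intro A hA
    have := finite_quotient_of_isInvertibleIdeal (R.invertible b.1 b.2)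
    have h1 : ∀ q : EtaleIntegers K ⧸ b.1, ∃ a ∈ A, ∃ r ∈ R.res b, -a + r = Quotient.out q := by
      intro q
      obtain ⟨a, ha, r, hr, h⟩ := Set.mem_add.1 (hA ▸ mem_univ (Quotient.out q))
      exact ⟨-a, ha, r, hr, by simpa using h⟩
    choose a ha r hr h using h1
    refine ⟨range a, finite_range a, by rintro _ ⟨q, rfl⟩; exact ha q, ?_⟩
    rw [eq_univ_iff_forall]
    intro y
    let q := Ideal.Quotient.mk b.1 y
    have hy : y - Quotient.out q ∈ b.1 := Ideal.Quotient.eq.1 (by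
      rw [Ideal.Quotient.mk_out])
    obtain ⟨S, _, hS⟩ := R.res_eq b
    refine Set.mem_add.2 ⟨-a q, by simp, r q + (y - Quotient.out q), ?_, ?_⟩
    · have h2 := hr q
      rw [hS] at h2 ⊢
      obtain ⟨s, hs, β, hβ, hsum⟩ := Set.mem_add.1 h2
      exact Set.mem_add.2 ⟨s, hs, β + (y - Quotient.out q), b.1.add_mem hβ hy, by
        rw [← add_assoc, hsum]⟩
    · rw [← add_assoc, h q]; abel

theorem admissible_shift (R : Sieve K) (a : EtaleIntegers K) (x : EtaleIntegers K → Bool)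
    (hx : R.Admissible (patternSet x)) : R.Admissible (patternSet (shift a x)) := by
  intro b hb
  apply hx b
  rw [eq_univ_iff_forall] at hb ⊢
  intro y
  obtain ⟨c, hc, r, hr, h⟩ := Set.mem_add.1 (hb (y + a))
  refine Set.mem_add.2 ⟨c - a, ?_, r, hr, by rw [sub_add_eq_add_sub, h]; abel⟩
  have : x (-c + a) = true := hc
  change x (-(c - a)) = true
  rwa [neg_sub, sub_eq_neg_add]

/-- `Ω_R`, the space of `R`-admissible sets. -/
def omega [Finite ι] [∀ i, NumberField (K i)] (R : Sieve K) : Subshift (EtaleIntegers K) where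
  carrier := {x | R.Admissible (patternSet x)}
  isClosed := R.isClosed_admissible
  shift_mem := R.admissible_shift

/-- `Y_{R, ≥ s}`, the space of the `R`-admissible sets `A` such that
`|A + b| ≤ |R_b^c| - s_b` for every `b`. -/
def yGe [Finite ι] [∀ i, NumberField (K i)] (R : Sieve K) (s : R.ideals → ℕ) :
    Subshift (EtaleIntegers K) where
  carrier := {x | R.Admissible (patternSet x) ∧
    ∀ b : R.ideals, cardMod b.1 (patternSet x) + s b ≤ R.complCard b}
  isClosed := by
    refine R.isClosed_admissible.inter ?_
    have : {x | ∀ b : R.ideals, cardMod b.1 (patternSet x) + s b ≤ R.complCard b} =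
        ⋂ b : R.ideals, {x | cardMod b.1 (patternSet x) + s b ≤ R.complCard b} := by
      ext x; simp
    change IsClosed {x | ∀ b : R.ideals, cardMod b.1 (patternSet x) + s b ≤ R.complCard b}
    rw [this]
    refine isClosed_iInter fun b => ⟨?_⟩
    have hc : {x | cardMod b.1 (patternSet x) + s b ≤ R.complCard b}ᶜ =
        {x | R.complCard b < cardMod b.1 (patternSet x) + s b} := by
      ext x; simp
    rw [hc]
    have := finite_quotient_of_isInvertibleIdeal (R.invertible b.1 b.2)
    refine isOpen_of_finite_witness
      (fun A => R.complCard b < cardMod b.1 A + s b) ?_ ?_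
    · intro A B hAB hA
      have : cardMod b.1 A ≤ cardMod b.1 B :=
        Set.ncard_le_ncard (Set.image_mono hAB) (Set.toFinite _)
      lia
    · intro A hA
      obtain ⟨F, hFA, hF, hFi⟩ := Set.exists_subset_bijOn A (Ideal.Quotient.mk b.1)
        |>.imp fun F h => (⟨h.1, h.2.finite_iff_finite.2 (Set.toFinite _), h.2.image_eq⟩ :
          F ⊆ A ∧ F.Finite ∧ Ideal.Quotient.mk b.1 '' F = Ideal.Quotient.mk b.1 '' A)
      refine ⟨F, hF, hFA, ?_⟩
      simpa only [cardMod, hFi] using hA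
  shift_mem := by
    rintro a x ⟨hx, hs⟩
    refine ⟨R.admissible_shift a x hx, fun b => ?_⟩
    have h1 : Ideal.Quotient.mk b.1 '' patternSet (shift a x) =
        (fun q => q - Ideal.Quotient.mk b.1 a) '' (Ideal.Quotient.mk b.1 '' patternSet x) := by
      rw [patternSet_shift, Set.image_image, Set.image_image]
      simp
    have h2 : cardMod b.1 (patternSet (shift a x)) = cardMod b.1 (patternSet x) := by
      rw [cardMod, h1]
      exact Set.ncard_image_of_injective _ (sub_left_injective)
    rw [h2]
    exact hs b

end Sieve

/-!
The entropy formula only uses that the ideals are pairwise coprime of finite index in a commutative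
ring `O`, which is infinite because it has infinitely many ideals. Write `c b = |R_b^c| - s_b`. All
factors `c b / N(b)` lie in `[0, 1]`, so the product converges unconditionally to the infimum of its
finite partial products. Moreover `Ω_R` is `Y_{R, ≥ 0}`, since an admissible set has for each `b` a
translate inside `R_b^c` (`Sieve.omega_eq_yGe_zero`).

*Upper bound* (`Subshift.coverEntropy_le`). By compactness a finite open cover is refined by the
cylinders over a finite window `W`, so that its join over `F` has a subcover indexed by the patterns
seen on `W + F`. Fix finitely many ideals `b`. A point of `Y` meets at most `c b` residue classes
modulo `b`, so up to a bounded number of choices of these classes its pattern is a subset of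
`(W + F) ∩ D`, where `D` is cut out by the chosen classes. Averaging over representatives of all the
residue classes, which exist by the Chinese remainder theorem, shows that an almost invariant `F`
has at most about `|F| ∏ c b / N(b)` points in `D` (`card_filter_mul_prod_card_le`). Since
`|F| → ∞` along the filter (`tendsto_card_folnerFilter`), the number of choices does not matter.

*Lower bound* (`Subshift.le_topEntropy`). Choose `c b` classes in `R_b^c` for each `b`. Given a
finite set `F`, some translate of the classes modulo the first ideal contains the expected proportion
of `F`, some translate of the classes modulo the second contains the expected proportion of what is
left, and so on. As `F` has finitely many subsets, this gives one subset `A` of `F` with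
`|A| ≥ |F| ∏ c b / N(b)` that is compatible with all ideals at once. Every subset of `A` is then a
point of `Y`, and these `2 ^ |A|` points lie in different members of the join over `F` of the cover
by the two cylinders at the origin. That `F` may be taken almost invariant, that is, that
`folnerFilter` is non-trivial, is the amenability of abelian groups (`exists_almost_invariant`),
which follows from polynomial growth.
-/

/-! ### Almost invariant finite sets -/

/-- The number of points of the symmetric difference of `x + F` and `F`. -/
noncomputable def shiftDefect {G : Type*} [AddCommGroup G] (x : G) (F : Finset G) : ℕ :=
  (symmDiff (x +ᵥ (F : Set G)) (F : Set G)).ncard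

section AlmostInvariant

variable {G : Type*} [AddCommGroup G]

theorem tendsto_shiftDefect_div_card (x : G) :
    Tendsto (fun F : Finset G => (shiftDefect x F : ℝ) / (F.card : ℝ)) (folnerFilter G) (𝓝 0) :=
  tendsto_comap.mono_left (inf_le_right.trans (iInf_le _ x))

theorem eventually_nonempty_folnerFilter : ∀ᶠ F in folnerFilter G, F.Nonempty :=
  mem_inf_of_left (mem_principal_self _)

theorem finite_symmDiff_vadd (x : G) (F : Finset G) :
    (symmDiff (x +ᵥ (F : Set G)) (F : Set G)).Finite :=
  (F.finite_toSet.vadd_set).symmDiff F.finite_toSet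

/-- Counting the points of `F` with a property after a translation costs at most the shift
defect. -/
theorem card_filter_le_card_filter_add_shiftDefect (x : G) (F : Finset G) (P : G → Prop)
    [DecidablePred P] :
    (F.filter P).card ≤ (F.filter (fun f => P (x + f))).card + shiftDefect x F := by
  classical
  have hfin := finite_symmDiff_vadd x F
  have hsub : F.filter P ⊆
      (F.filter (fun f => P (x + f))).image (x + ·) ∪ hfin.toFinset := by
    intro f hf
    rw [Finset.mem_filter] at hf
    rw [Finset.mem_union, Finset.mem_image, Finite.mem_toFinset]
    by_cases h : -x + f ∈ F
    · exact Or.inl ⟨-x + f, Finset.mem_filter.2 ⟨h, by simpa using hf.2⟩, by simp⟩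
    · refine Or.inr (Or.inr ⟨hf.1, fun h' => h ?_⟩)
      simpa [Set.mem_vadd_set_iff_neg_vadd_mem] using h'
  calc _ ≤ _ := Finset.card_le_card hsub
    _ ≤ _ := Finset.card_union_le _ _
    _ ≤ _ := by
      refine add_le_add Finset.card_image_le (le_of_eq ?_)
      rw [shiftDefect, Set.ncard_eq_toFinset_card _ hfin]

theorem card_vadd_sdiff_le_shiftDefect [DecidableEq G] (x : G) (F : Finset G) :
    ((x +ᵥ F) \ F).card ≤ shiftDefect x F := by
  rw [← Set.ncard_coe_finset]
  refine Set.ncard_le_ncard ?_ (finite_symmDiff_vadd x F)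
  rw [Finset.coe_sdiff, Finset.coe_vadd_finset]
  exact fun _ h => Or.inl h

open Classical in
theorem shiftDefect_le_of_subset {x : G} {F H : Finset G} (hF : F ⊆ H) (hx : x +ᵥ F ⊆ H) :
    shiftDefect x F ≤ 2 * (H.card - F.card) := by
  have hsub : symmDiff (x +ᵥ F) F ⊆ (H \ F) ∪ (H \ (x +ᵥ F)) := by
    intro a ha
    rw [Finset.mem_symmDiff] at ha
    simp only [Finset.mem_union, Finset.mem_sdiff]
    rcases ha with ha | ha
    · exact Or.inl ⟨hx ha.1, ha.2⟩
    · exact Or.inr ⟨hF ha.1, ha.2⟩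
  have h1 : shiftDefect x F = (symmDiff (x +ᵥ F) F).card := by
    rw [shiftDefect, ← Finset.coe_vadd_finset, ← Finset.coe_symmDiff, Set.ncard_coe_finset]
  have h2 := Finset.card_le_card hsub
  have h3 := Finset.card_union_le (H \ F) (H \ (x +ᵥ F))
  rw [Finset.card_sdiff_of_subset hF, Finset.card_sdiff_of_subset hx, Finset.card_vadd_finset] at h3
  omega

open Classical in
/-- The set of all combinations `∑ k_x x` (`x ∈ X`) with `0 ≤ k_x ≤ n`. -/
noncomputable def combinationBox (X : Finset G) (n : ℕ) : Finset G :=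
  (Fintype.piFinset fun _ : X => Finset.range (n + 1)).image fun k => ∑ x : X, k x • (x : G)

theorem zero_mem_combinationBox (X : Finset G) (n : ℕ) : 0 ∈ combinationBox X n :=
  by classical exact Finset.mem_image.2 ⟨0, by simp, by simp⟩

theorem card_combinationBox_le (X : Finset G) (n : ℕ) :
    (combinationBox X n).card ≤ (n + 1) ^ X.card :=
  by classical exact Finset.card_image_le.trans (by simp)

theorem combinationBox_subset_succ (X : Finset G) (n : ℕ) :
    combinationBox X n ⊆ combinationBox X (n + 1) := by
  classical
  refine Finset.image_subset_image (Fintype.piFinset_subset _ _ fun _ => ?_)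
  exact Finset.range_mono (by omega)

open Classical in
theorem vadd_combinationBox_subset_succ {X : Finset G} {x : G} (hx : x ∈ X) (n : ℕ) :
    x +ᵥ combinationBox X n ⊆ combinationBox X (n + 1) := by
  intro a ha
  obtain ⟨b, hb, rfl⟩ := Finset.mem_vadd_finset.1 ha
  obtain ⟨k, hk, rfl⟩ := Finset.mem_image.1 hb
  rw [Fintype.mem_piFinset] at hk
  refine Finset.mem_image.2 ⟨Pi.single ⟨x, hx⟩ 1 + k, ?_, ?_⟩
  · rw [Fintype.mem_piFinset]
    intro y
    have h1 := Finset.mem_range.1 (hk y)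
    have h2 : (Pi.single ⟨x, hx⟩ 1 : X → ℕ) y ≤ 1 := by
      rw [Pi.single_apply]
      split_ifs <;> simp
    rw [Finset.mem_range, Pi.add_apply]
    omega
  · simp [add_smul, Finset.sum_add_distrib, Pi.single_apply, ite_smul]

/-- Abelian groups are amenable: the boxes of combinations of a finite set grow polynomially, so
that their cardinality cannot grow by a factor `1 + ε` at every step. -/
theorem exists_almost_invariant (X : Finset G) {ε : ℝ} (hε : 0 < ε) :
    ∃ F : Finset G, F.Nonempty ∧ ∀ x ∈ X, (shiftDefect x F : ℝ) / F.card ≤ ε := by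
  classical
  let B := combinationBox X
  have hpos : ∀ n, 0 < (B n).card := fun n => Finset.card_pos.2 ⟨0, zero_mem_combinationBox X n⟩
  obtain ⟨n, hn⟩ : ∃ n, ((B (n + 1)).card : ℝ) ≤ (1 + ε / 2) * (B n).card := by
    by_contra! hcon
    have hgrow : ∀ n : ℕ, (1 + ε / 2) ^ n ≤ ((B n).card : ℝ) := by
      intro n
      induction n with
      | zero => simpa using hpos 0
      | succ n ih =>
        rw [pow_succ']
        exact (mul_le_mul_of_nonneg_left ih (by positivity)).trans (hcon n).le
    have hlim := (tendsto_pow_const_div_const_pow_of_one_lt X.card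
      (by linarith : 1 < 1 + ε / 2)).comp (tendsto_add_atTop_nat 1)
    have hsmall : ∀ᶠ n : ℕ in atTop,
        ((n + 1 : ℕ) : ℝ) ^ X.card / (1 + ε / 2) ^ (n + 1) < (1 + ε / 2)⁻¹ :=
      hlim.eventually_lt_const (by positivity)
    obtain ⟨n, hn⟩ := hsmall.exists
    have h1 : (1 + ε / 2) ^ n ≤ ((n + 1 : ℕ) : ℝ) ^ X.card :=
      (hgrow n).trans (by exact_mod_cast card_combinationBox_le X n)
    rw [div_lt_iff₀ (by positivity), pow_succ', inv_mul_cancel_left₀ (by positivity)] at hn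
    exact absurd h1 (not_le.2 hn)
  refine ⟨B n, Finset.card_pos.1 (hpos n), fun x hx => ?_⟩
  have hsub := combinationBox_subset_succ X n
  have h1 := shiftDefect_le_of_subset hsub (vadd_combinationBox_subset_succ hx n)
  have h2 : (shiftDefect x (B n) : ℝ) ≤ 2 * ((B (n + 1)).card - (B n).card) := by
    rw [← Nat.cast_sub (Finset.card_le_card hsub)]
    exact_mod_cast h1
  rw [div_le_iff₀ (by exact_mod_cast hpos n)]
  linarith

instance folnerFilter_neBot : (folnerFilter G).NeBot := by
  classical
  choose Φ hne hΦ using fun p : Finset G × ℕ =>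
    exists_almost_invariant p.1 (Nat.one_div_pos_of_nat (α := ℝ) (n := p.2))
  have hlim : Tendsto Φ (atTop ×ˢ atTop) (folnerFilter G) := by
    refine tendsto_inf.2 ⟨tendsto_principal.2 (Eventually.of_forall hne),
      tendsto_iInf.2 fun x => tendsto_comap_iff.2 ?_⟩
    refine squeeze_zero' (Eventually.of_forall fun p =>
      div_nonneg (Nat.cast_nonneg _) (Nat.cast_nonneg _)) ?_
      (tendsto_one_div_add_atTop_nhds_zero_nat.comp tendsto_snd)
    filter_upwards [tendsto_fst.eventually (eventually_ge_atTop {x})] with p hp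
    exact hΦ p x (hp (Finset.mem_singleton_self x))
  exact hlim.neBot

/-- In an infinite group, almost invariant sets are large: a small set with small relative defect
for `x` is exactly invariant under `x`, and so contains a translate of any prescribed set. -/
theorem tendsto_card_folnerFilter [Infinite G] :
    Tendsto (fun F : Finset G => F.card) (folnerFilter G) atTop := by
  rw [tendsto_atTop]
  intro M
  obtain ⟨X, hX⟩ := Infinite.exists_subset_card_eq G M
  have hdef : ∀ᶠ F in folnerFilter G, ∀ x ∈ X,
      (shiftDefect x F : ℝ) / F.card < 1 / ((M : ℝ) + 1) :=
    (Finset.eventually_all X).2 fun x _ =>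
      (tendsto_shiftDefect_div_card x).eventually_lt_const (by positivity)
  filter_upwards [hdef, eventually_nonempty_folnerFilter] with F hF hne
  by_contra! hlt
  obtain ⟨f, hf⟩ := hne
  have hpos : (0 : ℝ) < F.card := by exact_mod_cast Finset.card_pos.2 ⟨f, hf⟩
  have hmem : ∀ x ∈ X, x + f ∈ F := by
    intro x hx
    have h1 := hF x hx
    rw [div_lt_div_iff₀ hpos (by positivity), one_mul] at h1
    -- The relative defect is below `1 / |F|`, so the defect itself, an integer, vanishes.
    have h2 : shiftDefect x F = 0 := by
      by_contra h0
      have h3 : (1 : ℝ) ≤ shiftDefect x F := by exact_mod_cast Nat.one_le_iff_ne_zero.2 h0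
      have h4 : (F.card : ℝ) < M := by exact_mod_cast hlt
      nlinarith
    have h3 := (Set.ncard_eq_zero (finite_symmDiff_vadd x F)).1 h2
    have h4 : x +ᵥ (F : Set G) = F := symmDiff_eq_bot.1 h3
    exact Finset.mem_coe.1 (h4 ▸ Set.vadd_mem_vadd_set hf)
  have h5 : X.card ≤ F.card :=
    Finset.card_le_card_of_injOn (· + f) hmem (add_left_injective f).injOn
  omega

end AlmostInvariant

/-! ### Open covers of subshifts and patterns on finite windows -/

section Patterns

variable {G : Type*} [AddCommGroup G]

namespace Subshift

@[simp]
theorem vadd_apply (Y : Subshift G) (g m : G) (x : Y.carrier) : (g +ᵥ x).1 m = x.1 (m + g) :=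
  rfl

theorem isCompact_univ (Y : Subshift G) : IsCompact (univ : Set Y.carrier) :=
  isCompact_iff_isCompact_univ.1 Y.isClosed.isCompact

open Classical in
/-- The patterns that `Y` shows on the finite window `E`, encoded as subsets of `E`. -/
noncomputable def patterns (Y : Subshift G) (E : Finset G) : Finset (Finset G) :=
  E.powerset.filter fun P => ∃ x ∈ Y.carrier, E.filter (x · = true) = P

/-- A finite open cover of a subshift is refined by the cylinders over some finite window. -/
theorem exists_window (Y : Subshift G) {𝒰 : Set (Set Y.carrier)} (h𝒰 : IsFiniteOpenCover 𝒰) :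
    ∃ W : Finset G, ∀ x : Y.carrier, ∃ u ∈ 𝒰, ∀ y : Y.carrier,
      (∀ w ∈ W, y.1 w = x.1 w) → y ∈ u := by
  classical
  suffices h : ∃ W : Finset G, ∀ x ∈ (univ : Set Y.carrier), ∃ u ∈ 𝒰, ∀ y : Y.carrier,
      (∀ w ∈ W, y.1 w = x.1 w) → y ∈ u by simpa using h
  refine Y.isCompact_univ.induction_on ⟨∅, by simp⟩ ?_ ?_ ?_
  · rintro s t hst ⟨W, hW⟩
    exact ⟨W, fun x hx => hW x (hst hx)⟩
  · rintro s t ⟨W, hW⟩ ⟨V, hV⟩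
    refine ⟨W ∪ V, ?_⟩
    rintro x (hx | hx)
    · obtain ⟨u, hu, h⟩ := hW x hx
      exact ⟨u, hu, fun y hy => h y fun w hw => hy w (Finset.mem_union_left _ hw)⟩
    · obtain ⟨u, hu, h⟩ := hV x hx
      exact ⟨u, hu, fun y hy => h y fun w hw => hy w (Finset.mem_union_right _ hw)⟩
  · intro x _
    obtain ⟨u, hu, hxu⟩ := mem_sUnion.1 (h𝒰.2.2 ▸ mem_univ x : x ∈ ⋃₀ 𝒰)
    obtain ⟨v, hv, rfl⟩ := isOpen_induced_iff.1 (h𝒰.2.1 u hu)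
    obtain ⟨W, t, hWt, hsub⟩ := isOpen_pi_iff.1 hv x.1 hxu
    -- All points `z` of the cylinder of `x` over `W` have the same cylinder over `W`.
    refine ⟨{y | ∀ w ∈ W, y.1 w = x.1 w}, ?_, W, fun z hz => ⟨_, hu, fun y hy => ?_⟩⟩
    · rw [nhdsWithin_univ]
      have hopen : IsOpen ((W : Set G).pi fun w => ({x.1 w} : Set Bool)) :=
        isOpen_set_pi W.finite_toSet fun _ _ => isOpen_discrete _
      refine mem_of_superset ((hopen.preimage continuous_subtype_val).mem_nhds ?_) ?_
      · exact fun w _ => rfl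
      · exact fun y hy w hw => hy w hw
    · refine hsub fun w hw => ?_
      rw [hy w hw, hz w hw]
      exact (hWt w hw).2

open Classical in
/-- One point `x P` for each pattern `P` on `W + F` gives a subcover of the join over `F`: a point
with pattern `P` lies in the member that has the sets of the window property of the `g + x P`. -/
theorem minSubcoverCard_coverJoin_le (Y : Subshift G) {𝒰 : Set (Set Y.carrier)} {W : Finset G}
    (hW : ∀ x : Y.carrier, ∃ u ∈ 𝒰, ∀ y : Y.carrier, (∀ w ∈ W, y.1 w = x.1 w) → y ∈ u)
    (F : Finset G) :
    minSubcoverCard (coverJoin 𝒰 F) ≤ (Y.patterns (W + F)).card := by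
  have hP : ∀ P : Y.patterns (W + F), ∃ x : Y.carrier, (W + F).filter (x.1 · = true) = P := by
    rintro ⟨P, hP⟩
    obtain ⟨x, hx, h⟩ := (Finset.mem_filter.1 hP).2
    exact ⟨⟨x, hx⟩, h⟩
  choose x hx using hP
  choose u hu hmem using hW
  let w : Y.patterns (W + F) → Set Y.carrier := fun P =>
    ⋂ g ∈ F, {y : Y.carrier | g +ᵥ y ∈ u (g +ᵥ x P)}
  have hcard : (Finset.univ.image w).card ≤ (Y.patterns (W + F)).card :=
    Finset.card_image_le.trans (by simp)
  refine le_trans (Nat.sInf_le ⟨Finset.univ.image w, ?_, ?_, rfl⟩) hcard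
  · intro v hv
    obtain ⟨P, -, rfl⟩ := Finset.mem_image.1 (Finset.mem_coe.1 hv)
    exact ⟨fun g => u (g +ᵥ x P), fun g => hu _, rfl⟩
  · refine eq_univ_of_forall fun y => ?_
    have hy : (W + F).filter (y.1 · = true) ∈ Y.patterns (W + F) :=
      Finset.mem_filter.2 ⟨Finset.mem_powerset.2 (Finset.filter_subset _ _), y.1, y.2, rfl⟩
    refine mem_sUnion.2 ⟨w ⟨_, hy⟩, Finset.mem_coe.2
      (Finset.mem_image_of_mem _ (Finset.mem_univ _)), ?_⟩
    refine mem_iInter₂.2 fun g hg => hmem _ _ fun m hm => ?_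
    rw [vadd_apply, vadd_apply]
    have h := congrArg (m + g ∈ ·) (hx ⟨_, hy⟩)
    simp only [Finset.mem_filter, Finset.add_mem_add hm hg, true_and, eq_iff_iff] at h
    exact (Bool.eq_iff_iff.2 h).symm

/-- The cover of a subshift by the two cylinders over the origin. -/
def originCover (Y : Subshift G) : Set (Set Y.carrier) :=
  range fun i : Bool => {x : Y.carrier | x.1 0 = i}

theorem isFiniteOpenCover_originCover (Y : Subshift G) : IsFiniteOpenCover Y.originCover := by
  refine ⟨finite_range _, ?_, ?_⟩
  · rintro _ ⟨i, rfl⟩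
    have hcont : Continuous fun x : Y.carrier => x.1 0 :=
      (continuous_apply (0 : G)).comp continuous_subtype_val
    exact (isOpen_discrete {i}).preimage hcont
  · exact eq_univ_of_forall fun x => mem_sUnion.2 ⟨_, ⟨x.1 0, rfl⟩, rfl⟩

open Classical in
/-- If all subsets of a finite set `A ⊆ F` are points of `Y`, then no member of the join of the
origin cover over `F` contains two of them. -/
theorem two_pow_card_le_minSubcoverCard (Y : Subshift G) {A F : Finset G} (hAF : A ⊆ F)
    (hA : ∀ B ⊆ A, (fun m => decide (m ∈ B)) ∈ Y.carrier) :
    2 ^ A.card ≤ minSubcoverCard (coverJoin Y.originCover F) := by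
  -- The infimum defining `minSubcoverCard` is over a non-empty set, as finite subcovers exist.
  have hne : {n | ∃ 𝒱 : Finset (Set Y.carrier),
      (𝒱 : Set (Set Y.carrier)) ⊆ coverJoin Y.originCover F ∧
      ⋃₀ (𝒱 : Set (Set Y.carrier)) = univ ∧ 𝒱.card = n}.Nonempty := by
    have hfin : (coverJoin Y.originCover F).Finite := by
      refine (finite_range fun e : F → Bool => ⋂ g : F, {x : Y.carrier | x.1 g = e g}).subset ?_
      rintro _ ⟨u, hu, rfl⟩
      choose e he using hu
      refine ⟨fun g => e g, ?_⟩
      ext x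
      simp [← he]
    refine ⟨_, hfin.toFinset, by simp, eq_univ_of_forall fun x => ?_, rfl⟩
    rw [hfin.coe_toFinset]
    refine mem_sUnion.2 ⟨_, ⟨fun g => {y : Y.carrier | y.1 0 = x.1 g}, fun g => ⟨_, rfl⟩, rfl⟩, ?_⟩
    simp
  obtain ⟨𝒱, h𝒱, hcov, hcard⟩ := Nat.sInf_mem hne
  rw [minSubcoverCard, ← hcard, ← Finset.card_powerset]
  let pt : Finset G → G → Bool := fun B m => decide (m ∈ B)
  have hex : ∀ B ∈ A.powerset, ∃ v ∈ 𝒱, ∃ h : pt B ∈ Y.carrier, (⟨pt B, h⟩ : Y.carrier) ∈ v := by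
    intro B hB
    have h := hA B (Finset.mem_powerset.1 hB)
    obtain ⟨v, hv, hxv⟩ := mem_sUnion.1 (hcov ▸ mem_univ (⟨pt B, h⟩ : Y.carrier) :
      (⟨pt B, h⟩ : Y.carrier) ∈ ⋃₀ (𝒱 : Set (Set Y.carrier)))
    exact ⟨v, hv, h, hxv⟩
  choose! v hv hpt hmem using hex
  refine Finset.card_le_card_of_injOn v hv fun B hB C hC hBC => ?_
  obtain ⟨u, hu, hw⟩ := h𝒱 (hv B hB)
  have h1 := hmem B hB
  have h2 := hmem C hC
  rw [← hBC] at h2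
  rw [hw] at h1 h2
  ext m
  by_cases hm : m ∈ F
  · have h3 := mem_iInter₂.1 h1 m hm
    have h4 := mem_iInter₂.1 h2 m hm
    obtain ⟨i, hi⟩ := hu m
    simp only [← hi, mem_ofPred_eq, vadd_apply, zero_add, pt] at h3 h4
    exact decide_eq_decide.1 (h3.trans h4.symm)
  · exact iff_of_false (fun h => hm (hAF (Finset.mem_powerset.1 hB h)))
      (fun h => hm (hAF (Finset.mem_powerset.1 hC h)))

end Subshift

end Patterns

/-! ### The upper bound for the entropy -/

section UpperBound

variable {O : Type*} [CommRing O]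

open Classical in
/-- By the Chinese remainder theorem and an average over representatives `p v` of all residue
classes modulo all the `I b`, the density in an almost invariant set `F` of a set given by
conditions modulo the `I b` is almost at most the product of the local densities. -/
theorem card_filter_mul_prod_card_le {β : Type*} [Fintype β] {I : β → Ideal O}
    [∀ b, Fintype (O ⧸ I b)] {p : (∀ b, O ⧸ I b) → O}
    (hp : ∀ v b, Ideal.Quotient.mk (I b) (p v) = v b) (D : ∀ b, Finset (O ⧸ I b))
    (F : Finset O) :
    (F.filter fun f => ∀ b, Ideal.Quotient.mk (I b) f ∈ D b).card * ∏ b, Fintype.card (O ⧸ I b) ≤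
      F.card * ∏ b, (D b).card + ∑ v, shiftDefect (p v) F := by
  have hfib : ∀ f : O, (Finset.univ.filter fun v : ∀ b, O ⧸ I b =>
      ∀ b, v b + Ideal.Quotient.mk (I b) f ∈ D b).card = ∏ b, (D b).card := by
    intro f
    have h1 : (Finset.univ.filter fun v : ∀ b, O ⧸ I b =>
        ∀ b, v b + Ideal.Quotient.mk (I b) f ∈ D b) =
        Fintype.piFinset fun b => (D b).image (· - Ideal.Quotient.mk (I b) f) := by
      ext v
      simp [Fintype.mem_piFinset, sub_eq_iff_eq_add]
    rw [h1, Fintype.card_piFinset]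
    exact Finset.prod_congr rfl fun b _ => Finset.card_image_of_injective _ sub_left_injective
  have hswap : ∑ v : ∀ b, O ⧸ I b,
      (F.filter fun f => ∀ b, v b + Ideal.Quotient.mk (I b) f ∈ D b).card =
      F.card * ∏ b, (D b).card := by
    rw [← Finset.sum_const_nat fun f _ => hfib f]
    exact Finset.sum_card_bipartiteAbove_eq_sum_card_bipartiteBelow _
  rw [← hswap, ← Finset.sum_add_distrib, ← Fintype.card_pi, mul_comm, ← smul_eq_mul,
    ← Finset.card_univ, ← Finset.sum_const]
  refine Finset.sum_le_sum fun v _ => ?_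
  refine (card_filter_le_card_filter_add_shiftDefect (p v) F
    fun f => ∀ b, Ideal.Quotient.mk (I b) f ∈ D b).trans (le_of_eq ?_)
  simp [hp]

theorem card_filter_add_le {G : Type*} [AddCommGroup G] [DecidableEq G] (W F : Finset G)
    (P : G → Prop) [DecidablePred P] :
    ((W + F).filter P).card ≤ (F.filter P).card + ∑ w ∈ W, shiftDefect w F := by
  have hsub : (W + F).filter P ⊆ F.filter P ∪ W.biUnion fun w => (w +ᵥ F) \ F := by
    intro a ha
    obtain ⟨ha, hPa⟩ := Finset.mem_filter.1 ha
    by_cases haF : a ∈ F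
    · exact Finset.mem_union_left _ (Finset.mem_filter.2 ⟨haF, hPa⟩)
    · obtain ⟨w, hw, f, hf, rfl⟩ := Finset.mem_add.1 ha
      refine Finset.mem_union_right _ (Finset.mem_biUnion.2 ⟨w, hw, Finset.mem_sdiff.2 ⟨?_, haF⟩⟩)
      exact Finset.vadd_mem_vadd_finset hf
  calc _ ≤ _ := Finset.card_le_card hsub
    _ ≤ _ := Finset.card_union_le _ _
    _ ≤ _ := by
      refine add_le_add le_rfl (Finset.card_biUnion_le.trans (Finset.sum_le_sum fun w _ => ?_))
      exact card_vadd_sdiff_le_shiftDefect w F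

open Classical in
/-- A pattern on `E` is determined by the residue classes that the point meets, which leaves a
number of choices independent of `E`, and by a subset of the part of `E` in these classes. -/
theorem Subshift.card_patterns_le {β : Type*} [Fintype β] {I : β → Ideal O}
    [∀ b, Fintype (O ⧸ I b)] {c : β → ℕ} (Y : Subshift O)
    (hY : ∀ x ∈ Y.carrier, ∀ b, cardMod (I b) (patternSet x) ≤ c b) {E : Finset O} {m : ℕ}
    (hm : ∀ D : ∀ b, Finset (O ⧸ I b), (∀ b, (D b).card ≤ c b) →
      (E.filter fun f => ∀ b, Ideal.Quotient.mk (I b) f ∈ D b).card ≤ m) :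
    (Y.patterns E).card ≤ Fintype.card (∀ b, Finset (O ⧸ I b)) * 2 ^ m := by
  let 𝒟 : Finset (∀ b, Finset (O ⧸ I b)) := Finset.univ.filter fun D => ∀ b, (D b).card ≤ c b
  have hsub : Y.patterns E ⊆ 𝒟.biUnion fun D =>
      (E.filter fun f => ∀ b, Ideal.Quotient.mk (I b) f ∈ D b).powerset := by
    intro P hP
    obtain ⟨x, hx, rfl⟩ := (Finset.mem_filter.1 hP).2
    refine Finset.mem_biUnion.2
      ⟨fun b => (Ideal.Quotient.mk (I b) '' patternSet x).toFinset, ?_, ?_⟩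
    · refine Finset.mem_filter.2 ⟨Finset.mem_univ _, fun b => ?_⟩
      rw [← Set.ncard_eq_toFinset_card']
      exact hY x hx b
    · refine Finset.mem_powerset.2 fun f hf => ?_
      obtain ⟨hfE, hf⟩ := Finset.mem_filter.1 hf
      exact Finset.mem_filter.2 ⟨hfE, fun b => Set.mem_toFinset.2 ⟨f, hf, rfl⟩⟩
  calc _ ≤ _ := Finset.card_le_card hsub
    _ ≤ 𝒟.card * 2 ^ m := by
      refine Finset.card_biUnion_le_card_mul _ _ _ fun D hD => ?_
      rw [Finset.card_powerset]
      exact Nat.pow_le_pow_right two_pos (hm D (Finset.mem_filter.1 hD).2)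
    _ ≤ _ := Nat.mul_le_mul_right _ (Finset.card_le_univ _)

/-- If the points of a subshift meet at most `c b` residue classes modulo each of finitely many
pairwise coprime ideals `I b` of finite index, then its entropy is at most `log 2` times the
density `∏ c b / N (I b)`. -/
theorem Subshift.coverEntropy_le [Infinite O] {β : Type*} [Fintype β] {I : β → Ideal O}
    (hI : Pairwise (Function.onFun IsCoprime I)) (hfin : ∀ b, Finite (O ⧸ I b)) {c : β → ℕ}
    (Y : Subshift O) (hY : ∀ x ∈ Y.carrier, ∀ b, cardMod (I b) (patternSet x) ≤ c b)
    {𝒰 : Set (Set Y.carrier)} (h𝒰 : IsFiniteOpenCover 𝒰) :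
    coverEntropy O 𝒰 ≤
      ((Real.log 2 * ∏ b, ((c b : ℝ) / (idealNorm (I b) : ℝ)) : ℝ) : EReal) := by
  classical
  have := fun b => Fintype.ofFinite (O ⧸ I b)
  obtain ⟨W, hW⟩ := Y.exists_window h𝒰
  choose p hp using Ideal.pi_quotient_surjective hI
  set N := ∏ b, Fintype.card (O ⧸ I b) with hN
  have hNpos : 0 < N := Finset.prod_pos fun b _ => Fintype.card_pos
  set k := Fintype.card (∀ b, Finset (O ⧸ I b))
  have hk : 0 < k := Fintype.card_pos
  have hprod : ∏ b, ((c b : ℝ) / (idealNorm (I b) : ℝ)) = ((∏ b, c b : ℕ) : ℝ) / (N : ℝ) := by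
    simp [Finset.prod_div_distrib, hN, idealNorm]
  have hlim : Tendsto (fun F : Finset O => Real.log k / (F.card : ℝ) +
      (((∏ b, c b : ℕ) : ℝ) / (N : ℝ) +
        (∑ v, (shiftDefect (p v) F : ℝ) / (F.card : ℝ)) / (N : ℝ) +
        ∑ w ∈ W, (shiftDefect w F : ℝ) / (F.card : ℝ)) * Real.log 2) (folnerFilter O)
      (𝓝 (Real.log 2 * ∏ b, ((c b : ℝ) / (idealNorm (I b) : ℝ)))) := by
    have h1 : Tendsto (fun F : Finset O => Real.log k / (F.card : ℝ)) (folnerFilter O) (𝓝 0) :=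
      (tendsto_const_div_atTop_nhds_zero_nat _).comp tendsto_card_folnerFilter
    have h2 : Tendsto (fun F : Finset O => ∑ v, (shiftDefect (p v) F : ℝ) / (F.card : ℝ))
        (folnerFilter O) (𝓝 0) := by
      simpa using tendsto_finsetSum Finset.univ fun v _ => tendsto_shiftDefect_div_card (p v)
    have h3 : Tendsto (fun F : Finset O => ∑ w ∈ W, (shiftDefect w F : ℝ) / (F.card : ℝ))
        (folnerFilter O) (𝓝 0) := by
      simpa using tendsto_finsetSum W fun w _ => tendsto_shiftDefect_div_card w
    have h4 := h1.add ((((h2.div_const (N : ℝ)).const_add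
      (((∏ b, c b : ℕ) : ℝ) / (N : ℝ))).add h3).mul_const (Real.log 2))
    rw [hprod]
    convert h4 using 2
    ring
  refine (limsup_le_limsup ?_).trans
    (le_of_eq ((continuous_coe_real_ereal.tendsto _).comp hlim).limsup_eq)
  filter_upwards [eventually_nonempty_folnerFilter] with F hF
  have hFpos : (0 : ℝ) < F.card := by exact_mod_cast hF.card_pos
  -- An upper bound for the number of points of `W + F` that lie in the chosen residue classes; the
  -- rounding in the division by `N` goes in the right direction.
  let m := (F.card * ∏ b, c b + ∑ v, shiftDefect (p v) F) / N + ∑ w ∈ W, shiftDefect w F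
  have hcard : minSubcoverCard (coverJoin 𝒰 F) ≤ k * 2 ^ m := by
    refine (Y.minSubcoverCard_coverJoin_le hW F).trans (Y.card_patterns_le hY fun D hD => ?_)
    refine (card_filter_add_le W F _).trans (Nat.add_le_add_right ?_ _)
    refine (Nat.le_div_iff_mul_le hNpos).2 ((card_filter_mul_prod_card_le hp D F).trans ?_)
    exact Nat.add_le_add_right
      (Nat.mul_le_mul_left _ (Finset.prod_le_prod' fun b _ => hD b)) _
  have hlog : Real.log (minSubcoverCard (coverJoin 𝒰 F)) ≤ Real.log k + m * Real.log 2 := by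
    rw [← Real.log_pow, ← Real.log_mul (by positivity) (by positivity)]
    rcases Nat.eq_zero_or_pos (minSubcoverCard (coverJoin 𝒰 F)) with h0 | h0
    -- Here `Real.log 0 = 0`, and the right-hand side is non-negative.
    · rw [h0, Nat.cast_zero, Real.log_zero]
      exact Real.log_nonneg (by exact_mod_cast Nat.one_le_iff_ne_zero.2 (by positivity))
    · exact Real.log_le_log (by exact_mod_cast h0) (by exact_mod_cast hcard)
  have hm : (m : ℝ) ≤ ((∏ b, c b : ℕ) * F.card + ∑ v, (shiftDefect (p v) F : ℝ)) / N +
      ∑ w ∈ W, (shiftDefect w F : ℝ) := by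
    have h := Nat.cast_div_le (α := ℝ) (m := F.card * ∏ b, c b + ∑ v, shiftDefect (p v) F) (n := N)
    push_cast [m] at h ⊢
    rw [mul_comm (∏ b, (c b : ℝ))]
    gcongr
  refine EReal.coe_le_coe_iff.2 ?_
  have h2 : 0 ≤ Real.log 2 := Real.log_nonneg one_le_two
  rw [div_le_iff₀ hFpos, add_mul, div_mul_cancel₀ _ hFpos.ne', mul_right_comm]
  refine hlog.trans (add_le_add le_rfl (mul_le_mul_of_nonneg_right (hm.trans (le_of_eq ?_)) h2))
  rw [add_mul, add_mul, ← Finset.sum_div, ← Finset.sum_div, div_mul_cancel₀ _ hFpos.ne', add_div,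
    div_right_comm _ (F.card : ℝ), div_mul_cancel₀ _ hFpos.ne', div_mul_eq_mul_div]

end UpperBound

/-! ### The lower bound for the entropy -/

section LowerBound

variable {O : Type*} [CommRing O]

open Classical in
/-- On average over the translates, a set of `|C|` residue classes modulo `I` covers the proportion
`|C| / N(I)` of a finite set `A`; hence some translate covers at least that much. -/
theorem exists_translate_card_le {I : Ideal O} (hI : Finite (O ⧸ I)) (C : Finset (O ⧸ I))
    (A : Finset O) :
    ∃ t : O, A.card * C.card ≤
      idealNorm I * (A.filter fun a => Ideal.Quotient.mk I (a + t) ∈ C).card := by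
  have := Fintype.ofFinite (O ⧸ I)
  have hfib : ∀ a : O, (Finset.univ.filter fun q : O ⧸ I =>
      Ideal.Quotient.mk I a + q ∈ C).card = C.card := by
    intro a
    rw [← Finset.card_image_of_injective C (sub_left_injective (b := Ideal.Quotient.mk I a))]
    congr 1
    ext q
    simp [sub_eq_iff_eq_add, add_comm]
  have hswap : ∑ q : O ⧸ I, (A.filter fun a => Ideal.Quotient.mk I a + q ∈ C).card =
      A.card * C.card := by
    rw [← Finset.sum_const_nat fun a _ => hfib a]
    exact Finset.sum_card_bipartiteAbove_eq_sum_card_bipartiteBelow _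
  obtain ⟨q, -, hq⟩ := Finset.exists_max_image (Finset.univ : Finset (O ⧸ I))
    (fun q => (A.filter fun a => Ideal.Quotient.mk I a + q ∈ C).card) Finset.univ_nonempty
  obtain ⟨t, rfl⟩ := Ideal.Quotient.mk_surjective q
  refine ⟨t, ?_⟩
  rw [← hswap, idealNorm, Nat.card_eq_fintype_card]
  simpa using Finset.sum_le_card_nsmul _ _ _ hq

/-- Every finite set `F` contains a subset of relative density at least `∏ |C b| / N(I b)` that
lies in a translate of the classes `C b` modulo `I b`, for all `b` of a finite set `T`. -/
theorem exists_subset_forall_mem_translate {β : Type*} {I : β → Ideal O}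
    (hfin : ∀ b, Finite (O ⧸ I b)) (C : ∀ b, Finset (O ⧸ I b)) (F : Finset O) (T : Finset β) :
    ∃ A ⊆ F, F.card * ∏ b ∈ T, ((C b).card : ℝ) / (idealNorm (I b) : ℝ) ≤ A.card ∧
      ∀ b ∈ T, ∃ t : O, ∀ a ∈ A, Ideal.Quotient.mk (I b) (a + t) ∈ C b := by
  classical
  induction T using Finset.induction_on with
  | empty => exact ⟨F, subset_rfl, by simp, by simp⟩
  | insert b T hb ih =>
    obtain ⟨A, hAF, hcard, hA⟩ := ih
    obtain ⟨t, ht⟩ := exists_translate_card_le (hfin b) (C b) A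
    refine ⟨A.filter fun a => Ideal.Quotient.mk (I b) (a + t) ∈ C b,
      (Finset.filter_subset _ A).trans hAF, ?_, ?_⟩
    · have hpos : (0 : ℝ) < idealNorm (I b) := by
        have := hfin b
        exact_mod_cast (Nat.card_pos : 0 < Nat.card (O ⧸ I b))
      have ht' : (A.card : ℝ) * (C b).card ≤ idealNorm (I b) *
          (A.filter fun a => Ideal.Quotient.mk (I b) (a + t) ∈ C b).card := by
        exact_mod_cast ht
      rw [Finset.prod_insert hb, mul_left_comm, div_mul_eq_mul_div, div_le_iff₀ hpos, mul_comm,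
        mul_comm (Finset.card (Finset.filter _ _) : ℝ)]
      exact (mul_le_mul_of_nonneg_right hcard (Nat.cast_nonneg _)).trans ht'
    · intro b' hb'
      rcases Finset.mem_insert.1 hb' with rfl | hb'
      · exact ⟨t, fun a ha => (Finset.mem_filter.1 ha).2⟩
      · obtain ⟨t', ht'⟩ := hA b' hb'
        exact ⟨t', fun a ha => ht' a (Finset.mem_of_mem_filter a ha)⟩

/-- A choice from a finite set that is possible for each finite set of conditions is possible for
all conditions at once. -/
theorem Finset.exists_mem_forall_of_forall_finset {α β : Type*} (S : Finset α)
    (P : Finset β → α → Prop)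
    (hanti : ∀ T T', T ⊆ T' → ∀ a, P T' a → P T a) (h : ∀ T, ∃ a ∈ S, P T a) :
    ∃ a ∈ S, ∀ T, P T a := by
  classical
  by_contra! hcon
  choose! T hT using hcon
  obtain ⟨a, ha, hPa⟩ := h (S.biUnion T)
  exact hT a ha (hanti _ _ (Finset.subset_biUnion_of_mem T ha) a hPa)

/-- If a subshift contains every set that lies, for each `b`, in a translate of the classes `C b`
modulo `I b`, then its entropy is at least `log 2` times any lower bound `d` for the finite partial
products of the densities `|C b| / N(I b)`. -/
theorem Subshift.le_topEntropy {β : Type*} {I : β → Ideal O} (hfin : ∀ b, Finite (O ⧸ I b))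
    (C : ∀ b, Finset (O ⧸ I b)) (Y : Subshift O)
    (hY : ∀ x : O → Bool,
      (∀ b, ∃ t : O, ∀ a ∈ patternSet x, Ideal.Quotient.mk (I b) (a + t) ∈ C b) → x ∈ Y.carrier)
    {d : ℝ} (hd : ∀ T : Finset β, d ≤ ∏ b ∈ T, ((C b).card : ℝ) / (idealNorm (I b) : ℝ)) :
    ((Real.log 2 * d : ℝ) : EReal) ≤ topEntropy O Y.carrier := by
  classical
  refine le_trans ?_ (le_iSup₂ (f := fun (𝒰 : Set (Set Y.carrier)) (_ : IsFiniteOpenCover 𝒰) =>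
    coverEntropy O 𝒰) Y.originCover Y.isFiniteOpenCover_originCover)
  refine le_limsup_of_frequently_le' (Eventually.frequently ?_)
  filter_upwards [eventually_nonempty_folnerFilter] with F hF
  obtain ⟨A, hAF, hA⟩ := F.powerset.exists_mem_forall_of_forall_finset
    (fun T A => F.card * d ≤ A.card ∧
      ∀ b ∈ T, ∃ t : O, ∀ a ∈ A, Ideal.Quotient.mk (I b) (a + t) ∈ C b)
    (fun T T' hT A h => ⟨h.1, fun b hb => h.2 b (hT hb)⟩)
    (fun T => by
      obtain ⟨A, hAF, hcard, hA⟩ := exists_subset_forall_mem_translate hfin C F T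
      exact ⟨A, Finset.mem_powerset.2 hAF,
        (mul_le_mul_of_nonneg_left (hd T) (Nat.cast_nonneg _)).trans hcard, hA⟩)
  have hpow : 2 ^ A.card ≤ minSubcoverCard (coverJoin Y.originCover F) := by
    refine Y.two_pow_card_le_minSubcoverCard (Finset.mem_powerset.1 hAF) fun B hB => hY _ fun b => ?_
    obtain ⟨t, ht⟩ := (hA {b}).2 b (Finset.mem_singleton_self b)
    exact ⟨t, fun a ha => ht a (hB (by simpa [patternSet] using ha))⟩
  have hFpos : (0 : ℝ) < F.card := by exact_mod_cast hF.card_pos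
  refine EReal.coe_le_coe_iff.2 ((le_div_iff₀ hFpos).2 ?_)
  calc Real.log 2 * d * F.card = F.card * d * Real.log 2 := by ring
    _ ≤ A.card * Real.log 2 :=
      mul_le_mul_of_nonneg_right (hA ∅).1 (Real.log_nonneg one_le_two)
    _ = Real.log (2 ^ A.card : ℕ) := by simp
    _ ≤ _ := Real.log_le_log (by positivity) (by exact_mod_cast hpow)

end LowerBound

/-! ### Sieves -/

theorem hasProd_iInf_of_mem_Icc {β : Type*} {f : β → ℝ} (h0 : ∀ b, 0 ≤ f b) (h1 : ∀ b, f b ≤ 1) :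
    HasProd f (⨅ T : Finset β, ∏ b ∈ T, f b) := by
  classical
  refine tendsto_atTop_ciInf (fun S T hST => ?_)
    ⟨0, by rintro _ ⟨T, rfl⟩; exact Finset.prod_nonneg fun b _ => h0 b⟩
  change ∏ b ∈ T, f b ≤ ∏ b ∈ S, f b
  rw [← Finset.prod_sdiff hST]
  exact mul_le_of_le_one_left (Finset.prod_nonneg fun b _ => h0 b)
    (Finset.prod_le_one (fun b _ => h0 b) fun b _ => h1 b)

namespace Sieve

variable {ι : Type*} {K : ι → Type*} [∀ i, Field (K i)]

theorem mem_res_of_mk_eq (R : Sieve K) (b : R.ideals) {x y : EtaleIntegers K}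
    (h : Ideal.Quotient.mk b.1 x = Ideal.Quotient.mk b.1 y) (hx : x ∈ R.res b) : y ∈ R.res b := by
  obtain ⟨S, -, hS⟩ := R.res_eq b
  rw [hS] at hx ⊢
  obtain ⟨s, hs, β, hβ, rfl⟩ := Set.mem_add.1 hx
  refine Set.mem_add.2 ⟨s, hs, y - s, ?_, by abel⟩
  have h1 : y - (s + β) ∈ b.1 := Ideal.Quotient.eq.1 h.symm
  have h2 : y - s = (y - (s + β)) + β := by abel
  rw [h2]
  exact b.1.add_mem h1 hβ

theorem admissible_iff (R : Sieve K) (A : Set (EtaleIntegers K)) :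
    R.Admissible A ↔ ∀ b : R.ideals, ∃ t, ∀ a ∈ A, a + t ∉ R.res b := by
  refine forall_congr' fun b => ?_
  rw [Ne, eq_univ_iff_forall, not_forall]
  refine exists_congr fun t => ⟨fun h a ha hr => h ?_, fun h ht => ?_⟩
  · exact Set.mem_add.2 ⟨-a, by simpa using ha, a + t, hr, by abel⟩
  · obtain ⟨c, hc, r, hr, rfl⟩ := Set.mem_add.1 ht
    exact h (-c) hc (by simpa using hr)

/-- A ring with infinitely many ideals is infinite. -/
theorem infinite_etaleIntegers (R : Sieve K) : Infinite (EtaleIntegers K) := by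
  by_contra h
  rw [not_infinite_iff_finite] at h
  have : Finite (Ideal (EtaleIntegers K)) := Finite.of_injective _ SetLike.coe_injective
  exact R.infinite (Set.toFinite _)

theorem pairwise_isCoprime (R : Sieve K) :
    Pairwise (Function.onFun IsCoprime fun b : R.ideals => b.1) := fun b b' h =>
  Ideal.isCoprime_iff_sup_eq.2 (R.coprime b.2 b'.2 fun h' => h (Subtype.ext h'))

variable [Finite ι] [∀ i, NumberField (K i)]

theorem finite_quotient (R : Sieve K) (b : R.ideals) : Finite (EtaleIntegers K ⧸ b.1) :=
  finite_quotient_of_isInvertibleIdeal (R.invertible b.1 b.2)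

theorem resCard_add_complCard (R : Sieve K) (b : R.ideals) :
    R.resCard b + R.complCard b = idealNorm b.1 := by
  have := R.finite_quotient b
  have hcompl : Ideal.Quotient.mk b.1 '' (R.res b)ᶜ = (Ideal.Quotient.mk b.1 '' R.res b)ᶜ := by
    ext q
    obtain ⟨y, rfl⟩ := Ideal.Quotient.mk_surjective q
    constructor
    · rintro ⟨x, hx, hxy⟩ ⟨z, hz, hzy⟩
      exact hx (R.mem_res_of_mk_eq b (hzy.trans hxy.symm) hz)
    · exact fun h => ⟨y, fun hy => h ⟨y, hy, rfl⟩, rfl⟩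
  rw [resCard, complCard, cardMod, cardMod, hcompl, idealNorm, Set.ncard_add_ncard_compl]

theorem idealNorm_pos (R : Sieve K) (b : R.ideals) : 0 < idealNorm b.1 := by
  have := R.finite_quotient b
  exact Nat.card_pos

theorem cardMod_le_complCard (R : Sieve K) {A : Set (EtaleIntegers K)} (hA : R.Admissible A)
    (b : R.ideals) : cardMod b.1 A ≤ R.complCard b := by
  have := R.finite_quotient b
  obtain ⟨t, ht⟩ := (R.admissible_iff A).1 hA b
  refine Set.ncard_le_ncard_of_injOn (· + Ideal.Quotient.mk b.1 t) ?_
    (add_left_injective _).injOn (Set.toFinite _)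
  rintro _ ⟨a, ha, rfl⟩
  exact ⟨a + t, ht a ha, map_add _ _ _⟩

theorem omega_eq_yGe_zero (R : Sieve K) : R.omega = R.yGe 0 := by
  have h : R.omega.carrier = (R.yGe 0).carrier := by
    ext x
    exact ⟨fun hx => ⟨hx, fun b => by simpa using R.cardMod_le_complCard hx b⟩, fun hx => hx.1⟩
  cases hO : R.omega
  cases hY : R.yGe 0
  simpa [hO, hY] using h

/-- The local density `(|R_b^c| - s_b) / N(b)`. -/
noncomputable def localDensity (R : Sieve K) (s : R.ideals → ℕ) (b : R.ideals) : ℝ :=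
  ((R.complCard b - s b : ℕ) : ℝ) / (idealNorm b.1 : ℝ)

theorem hasProd_localDensity (R : Sieve K) (s : R.ideals → ℕ) :
    HasProd (R.localDensity s) (⨅ T : Finset R.ideals, ∏ b ∈ T, R.localDensity s b) := by
  refine hasProd_iInf_of_mem_Icc (fun b => div_nonneg (Nat.cast_nonneg _) (Nat.cast_nonneg _))
    fun b => div_le_one_of_le₀ ?_ (Nat.cast_nonneg _)
  have := R.resCard_add_complCard b
  exact_mod_cast (by omega : R.complCard b - s b ≤ idealNorm b.1)

theorem topEntropy_yGe_le (R : Sieve K) (s : R.ideals → ℕ) :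
    topEntropy (EtaleIntegers K) (R.yGe s).carrier ≤
      ((Real.log 2 * ∏' b, R.localDensity s b : ℝ) : EReal) := by
  have := R.infinite_etaleIntegers
  refine iSup₂_le fun 𝒰 h𝒰 => ?_
  have hprod := (R.hasProd_localDensity s).multipliable.hasProd
  refine ge_of_tendsto' ((continuous_coe_real_ereal.tendsto _).comp (hprod.const_mul (Real.log 2)))
    fun T => ?_
  have h := (R.yGe s).coverEntropy_le (I := fun b : T => b.1.1)
    (c := fun b : T => R.complCard b.1 - s b.1)
    (fun b b' hb => R.pairwise_isCoprime fun h => hb (Subtype.ext h))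
    (fun b => R.finite_quotient b.1) (fun x hx b => Nat.le_sub_of_add_le (hx.2 b.1)) h𝒰
  refine h.trans (le_of_eq ?_)
  rw [Function.comp_apply, ← Finset.prod_coe_sort T (R.localDensity s)]
  rfl

theorem le_topEntropy_yGe (R : Sieve K) {s : R.ideals → ℕ} (hs : ∀ b, s b ≤ R.complCard b) :
    ((Real.log 2 * ∏' b, R.localDensity s b : ℝ) : EReal) ≤
      topEntropy (EtaleIntegers K) (R.yGe s).carrier := by
  classical
  have := R.finite_quotient
  have hC : ∀ b : R.ideals, ∃ C : Finset (EtaleIntegers K ⧸ b.1),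
      (C : Set (EtaleIntegers K ⧸ b.1)) ⊆ Ideal.Quotient.mk b.1 '' (R.res b)ᶜ ∧
        C.card = R.complCard b - s b := by
    intro b
    have hfin := Set.toFinite (Ideal.Quotient.mk b.1 '' (R.res b)ᶜ)
    obtain ⟨C, hC, hcard⟩ := Finset.exists_subset_card_eq (s := hfin.toFinset)
      (n := R.complCard b - s b)
      (by rw [← Set.ncard_eq_toFinset_card]; exact Nat.sub_le _ _)
    exact ⟨C, fun q hq => hfin.mem_toFinset.1 (hC hq), hcard⟩
  choose C hCsub hCcard using hC
  refine (R.yGe s).le_topEntropy R.finite_quotient C (fun x hx => ⟨?_, fun b => ?_⟩) fun T => ?_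
  · refine (R.admissible_iff _).2 fun b => ?_
    obtain ⟨t, ht⟩ := hx b
    refine ⟨t, fun a ha hr => ?_⟩
    obtain ⟨r, hr', h⟩ := hCsub b (ht a ha)
    exact hr' (R.mem_res_of_mk_eq b h.symm hr)
  · obtain ⟨t, ht⟩ := hx b
    have h1 : cardMod b.1 (patternSet x) ≤ (C b : Set (EtaleIntegers K ⧸ b.1)).ncard := by
      refine Set.ncard_le_ncard_of_injOn (· + Ideal.Quotient.mk b.1 t) ?_
        (add_left_injective _).injOn (Set.toFinite _)
      rintro _ ⟨a, ha, rfl⟩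
      exact map_add (Ideal.Quotient.mk b.1) a t ▸ ht a ha
    rw [Set.ncard_coe_finset, hCcard] at h1
    have := hs b
    omega
  · rw [(R.hasProd_localDensity s).tprod_eq]
    simp only [hCcard]
    exact ciInf_le ⟨0, by
      rintro _ ⟨T, rfl⟩
      exact Finset.prod_nonneg fun b _ => div_nonneg (Nat.cast_nonneg _) (Nat.cast_nonneg _)⟩ T

theorem topEntropy_yGe (R : Sieve K) {s : R.ideals → ℕ} (hs : ∀ b, s b ≤ R.complCard b) :
    topEntropy (EtaleIntegers K) (R.yGe s).carrier =
      ((Real.log 2 * ∏' b, R.localDensity s b : ℝ) : EReal) :=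
  le_antisymm (R.topEntropy_yGe_le s) (R.le_topEntropy_yGe hs)

end Sieve

theorem mainTheorem3 {ι : Type*} [Finite ι] (K : ι → Type*) [∀ i, Field (K i)]
    [∀ i, NumberField (K i)] (R : Sieve K) :
    (∀ s : R.ideals → ℕ, (∀ b, s b ≤ R.complCard b) →
      Multipliable (fun b : R.ideals =>
        ((R.complCard b : ℝ) - (s b : ℝ)) / (idealNorm b.1 : ℝ)) ∧
      topEntropy (EtaleIntegers K) (R.yGe s).carrier =
        ((Real.log 2 * ∏' b : R.ideals,
          (((R.complCard b : ℝ) - (s b : ℝ)) / (idealNorm b.1 : ℝ)) : ℝ) : EReal)) ∧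
    Multipliable (fun b : R.ideals => 1 - (R.resCard b : ℝ) / (idealNorm b.1 : ℝ)) ∧
    topEntropy (EtaleIntegers K) R.omega.carrier =
      ((Real.log 2 * ∏' b : R.ideals,
        (1 - (R.resCard b : ℝ) / (idealNorm b.1 : ℝ)) : ℝ) : EReal) := by
  have h : ∀ s : R.ideals → ℕ, (∀ b, s b ≤ R.complCard b) →
      (fun b : R.ideals => ((R.complCard b : ℝ) - (s b : ℝ)) / (idealNorm b.1 : ℝ)) =
        R.localDensity s := fun s hs => funext fun b => by
    rw [Sieve.localDensity, Nat.cast_sub (hs b)]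
  have h0 : (fun b : R.ideals => 1 - (R.resCard b : ℝ) / (idealNorm b.1 : ℝ)) =
      R.localDensity 0 := funext fun b => by
    have h1 : (idealNorm b.1 : ℝ) ≠ 0 := by exact_mod_cast (R.idealNorm_pos b).ne'
    have h2 : (R.resCard b : ℝ) + R.complCard b = idealNorm b.1 := by
      exact_mod_cast R.resCard_add_complCard b
    rw [Sieve.localDensity, one_sub_div h1, ← h2]
    simp
  refine ⟨fun s hs => ?_, ?_, ?_⟩
  · rw [h s hs]
    exact ⟨(R.hasProd_localDensity s).multipliable, R.topEntropy_yGe hs⟩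
  · rw [h0]
    exact (R.hasProd_localDensity 0).multipliable
  · rw [h0, R.omega_eq_yGe_zero]
    exact R.topEntropy_yGe fun _ => Nat.zero_le _
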